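/- Let $d\ge 1$, $n\ge d+2$ and $k=n-d-1$. Let $\mathcal A=\{a_1,\dots,a_n\}\subset\mathbb R^d$ consist of $n$ distinct points such that the matrix $A\in\mathbb R^{(d+1)\times n}$ with columns $(1,a_1),\dots,(1,a_n)$ has rank $d+1$. Let $C=(c_{ij})\in\mathbb R^{d\times n}$ be uniform, i.e. no maximal ($d\times d$) minor of $C$ vanishes, and suppose that $0=\sum_{j=1}^n\lambda_jC_j$ for some $\lambda_1,\dots,\lambda_n>0$, where $C_1,\dots,C_n$ are the columns of $C$. Let $B=(b_{ij})\in\mathbb R^{n\times k}$ and $D=(d_{ij})\in\mathbb R^{n\times(k+1)}$ be Gale dual matrices of $A$ and $C$, i.e. the columns of $B$ form a basis of $\ker A$ and the columns of $D$ form a basis of $\ker C$. Number the columns of $B$ from $1$ to $k$ and those of $D$ from $0$ to $k$, and let $P_1,\dots,P_n\in\mathbb R^{k+1}$ be the rows of $D$. Put $$\Delta_P=\{y=(y_0,\dots,y_k)\in\mathbb R^{k+1} : y_0=1,\ \langle P_i,y\rangle>0 \text{ for } i=1,\dots,n\},$$ and assume that $\Delta_P$ is bounded and of full dimension $k$. Let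 $I_C\subset\{1,\dots,n\}$ be the index set of the minimal set of generators $\{P_i : i\in I_C\}$ of the polyhedral cone generated by $P_1,\dots,P_n$. For $i\in I_C$ let $F_i=\{y\in\overline{\Delta_P} : \langle P_i,y\rangle=0\}$, and for nonempty $L\subset I_C$ let $F_L=\bigcap_{i\in L}F_i$. Let $\mathcal F(\Delta_P)$ be the family of all nonempty $L\subset I_C$ for which $F_L$ is a nonempty face of $\overline{\Delta_P}$. A matrix is called weakly mixed if each of its columns either has only zero entries or contains both a positive and a negative entry. Suppose that 1. for every $L\in\mathcal F(\Delta_P)$ the submatrix $B_L$ of $B$ formed by the rows with index in $L$ is not weakly mixed; 2. for every $i\in I_C$: $b_{ij}d_{ij}\ge0$ for all $j\in\{1,\dots,k\}$; $b_{ij}d_{ij}>0$ for some $j\in\{1,\dots,k\}$; and for all $j\in\{1,\dots,k\}$, $b_{ij}=0$ implies $d_{ij}=0$. Then the system of generalized polynomial equations $$\sum_{j=1}^n c_{ij}x^{a_j}=0,\qquad i=1,\dots,d,$$ has at least one solution $x\in\mathbb R_{>0}^d$. -/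

import Mathlib

namespace GaleDuality

/-- The matrix with columns `(1, a_1), …, (1, a_n)` of a point configuration in `ℝ^d`. -/
def configMatrix {d n : ℕ} (a : Fin n → Fin d → ℝ) : Matrix (Fin (d + 1)) (Fin n) ℝ :=
  Matrix.of fun i j => (Fin.cons (1 : ℝ) (a j) : Fin (d + 1) → ℝ) i

/-- The set of positive solutions of the generalized polynomial system
`∑_j c_{ij} x^{a_j} = 0`, `i = 1, …, d`. -/
def positiveSolutions {d n : ℕ} (a : Fin n → Fin d → ℝ) (C : Matrix (Fin d) (Fin n) ℝ) :
    Set (Fin d → ℝ) :=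
  {x | (∀ l, 0 < x l) ∧ ∀ i, ∑ j, C i j * ∏ l, x l ^ a j l = 0}

/-- The (possibly infinite) number of positive solutions of the system. -/
noncomputable def numPositiveSolutions {d n : ℕ} (a : Fin n → Fin d → ℝ)
    (C : Matrix (Fin d) (Fin n) ℝ) : ℕ∞ :=
  (positiveSolutions a C).encard

/-- An `r × s` matrix (with `r ≤ s`) is uniform if none of its maximal minors vanishes. -/
def IsUniform {r s : ℕ} (M : Matrix (Fin r) (Fin s) ℝ) : Prop :=
  ∀ f : Fin r ↪ Fin s, (M.submatrix id f).det ≠ 0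

/-- `N` is a Gale dual matrix of `M`: `M` has maximal rank `r` and the columns of `N` are a basis
of the kernel of `M` (so that necessarily `t = s - r`). -/
structure IsGaleDual {r s t : ℕ} (M : Matrix (Fin r) (Fin s) ℝ) (N : Matrix (Fin s) (Fin t) ℝ) :
    Prop where
  rank_eq : M.rank = r
  linearIndependent : LinearIndependent ℝ N.col
  span_eq : Submodule.span ℝ (Set.range N.col) = LinearMap.ker M.mulVecLin

/-- The open cone `ℝ_{>0} C_1 + ⋯ + ℝ_{>0} C_n` generated by the columns of `C`. -/
def openColumnCone {d n : ℕ} (C : Matrix (Fin d) (Fin n) ℝ) : Set (Fin d → ℝ) :=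
  {v | ∃ c : Fin n → ℝ, (∀ j, 0 < c j) ∧ v = ∑ j, c j • C.col j}

/-- `Δ_P`: the points `y = (y_0, …, y_k)` with `y_0 = 1` and `⟨P_i, y⟩ > 0` for every row `P_i`
of `D`. -/
def deltaP {n k : ℕ} (D : Matrix (Fin n) (Fin (k + 1)) ℝ) : Set (Fin (k + 1) → ℝ) :=
  {y | (∀ i, 0 < D.row i ⬝ᵥ y) ∧ y 0 = 1}

/-- `I` is an index set of a minimal set of generators `{P_i : i ∈ I}` of the polyhedral cone
generated by the rows of `D`. -/
def IsMinimalGeneratorSet {n k : ℕ} (D : Matrix (Fin n) (Fin (k + 1)) ℝ) (I : Set (Fin n)) :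
    Prop :=
  Minimal (fun J : Set (Fin n) =>
    PointedCone.hull ℝ (D.row '' J) = PointedCone.hull ℝ (Set.range D.row)) I

/-- `F_i`: the part of the closure of `Δ_P` on the hyperplane `⟨P_i, y⟩ = 0`. -/
def facet {n k : ℕ} (D : Matrix (Fin n) (Fin (k + 1)) ℝ) (i : Fin n) : Set (Fin (k + 1) → ℝ) :=
  {y ∈ closure (deltaP D) | D.row i ⬝ᵥ y = 0}

/-- `F_L = ⋂_{i ∈ L} F_i`. -/
def faceOf {n k : ℕ} (D : Matrix (Fin n) (Fin (k + 1)) ℝ) (L : Set (Fin n)) :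
    Set (Fin (k + 1) → ℝ) :=
  ⋂ i ∈ L, facet D i

/-- The family `ℱ(Δ_P)`: the nonempty `L ⊆ I` such that `F_L` is a (nonempty) face of the closure
of `Δ_P`. -/
def faceFamily {n k : ℕ} (D : Matrix (Fin n) (Fin (k + 1)) ℝ) (I : Set (Fin n)) :
    Set (Set (Fin n)) :=
  {L | L ⊆ I ∧ L.Nonempty ∧ (faceOf D L).Nonempty ∧ IsExposed ℝ (closure (deltaP D)) (faceOf D L)}

/-- A matrix is weakly mixed if each column either has only zero entries, or contains a positive
and a negative entry. -/
def IsWeaklyMixed {m p : Type*} (M : Matrix m p ℝ) : Prop :=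
  ∀ j, (∀ i, M i j = 0) ∨ ((∃ i, 0 < M i j) ∧ ∃ i, M i j < 0)

end GaleDuality

open GaleDuality

open MeasureTheory Metric Set Filter Topology

namespace GaleDuality

/-! ### Volume of the ball under perturbations of the identity. -/

section Degree

variable {E : Type*} [NormedAddCommGroup E] [NormedSpace ℝ E]

/-! Write p_i(z) = ⟨P_i, (1, z)⟩. By Gale duality it suffices to find z in the open bounded polytope
p_i > 0 with ∑_i b_ij log p_i(z) = 0 for all j (`positiveSolutions_nonempty_of_gale`). This map is
deformed for s in [0, 1] to z - z₀, with z₀ an interior point. On the way the coefficients move from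
B to D and the logarithmic part is damped by 1 - s.

The main point is that no zero approaches the boundary (`eventually_galeHomotopy_ne_zero`). At a
boundary point y let L index the vanishing forms. Uniformity of C forces L ⊆ I_C, so L lies in the
face family. For s < 1, a nonzero column of B_L of constant sign, whose sign the corresponding
entries of D share weakly, drives one coordinate to ±∞. At s = 1, pairing with z₀ - y gives a
negative value.

Existence of a zero is then a degree argument (`exists_eq_zero_of_homotopy`). It reduces to the
no-retraction theorem, which is proved by the volume-polynomial method: ∫ det(1 + t Dv) over a ball
is a polynomial in t, constant for small t and hence for all t. -/

theorem lipschitzWith_indicator_ball {v : E → E} {R : ℝ} {K : NNReal}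
    (hv : LipschitzOnWith K v (closedBall 0 R)) (h0 : ∀ x ∈ sphere (0 : E) R, v x = 0) :
    LipschitzWith K ((ball (0 : E) R).indicator v) := by
  have hcl : ∀ x, ‖x‖ ≤ R → (ball (0 : E) R).indicator v x = v x := by
    intro x hx
    by_cases h : x ∈ ball (0 : E) R
    · simp [h]
    · rw [indicator_of_notMem h, h0 x]
      simp at h ⊢
      linarith
  -- The segment from x to y meets the sphere, where v vanishes; the crossing point is no farther
  -- from x than y is.
  have key : ∀ x y, ‖x‖ ≤ R → R ≤ ‖y‖ → ‖v x‖ ≤ K * ‖x - y‖ := by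
    intro x y hx hy
    have hc : ContinuousOn (fun t : ℝ => ‖x + t • (y - x)‖) (Icc 0 1) := by fun_prop
    obtain ⟨t, ht, hRt⟩ := intermediate_value_Icc zero_le_one hc (show R ∈ Icc _ _ by simp [hx, hy])
    have h1 := hv.dist_le_mul x (by simpa using hx) (x + t • (y - x)) (by simpa using hRt.le)
    rw [h0 (x + t • (y - x)) (by simpa using hRt), dist_zero_right] at h1
    refine h1.trans ?_
    gcongr
    rw [dist_eq_norm, sub_add_cancel_left, norm_neg, norm_smul, ← norm_neg (y - x), neg_sub,
      Real.norm_of_nonneg ht.1]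
    exact mul_le_of_le_one_left (norm_nonneg _) ht.2
  refine LipschitzWith.of_dist_le_mul fun x y => ?_
  rcases le_or_gt ‖x‖ R with hx | hx <;> rcases le_or_gt ‖y‖ R with hy | hy
  · rw [hcl x hx, hcl y hy]
    exact hv.dist_le_mul x (by simpa using hx) y (by simpa using hy)
  · rw [hcl x hx, indicator_of_notMem (by simpa using hy.le), dist_zero_right, dist_eq_norm]
    exact key x y hx hy.le
  · rw [hcl y hy, indicator_of_notMem (by simpa using hx.le), dist_zero_left, dist_comm,
      dist_eq_norm]
    exact key y x hy hx.le
  · rw [indicator_of_notMem (by simpa using hx.le), indicator_of_notMem (by simpa using hy.le)]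
    simp only [dist_self]; positivity

variable [FiniteDimensional ℝ E]

/-- `t ↦ det (1 + t A)` is a polynomial of degree at most the dimension. -/
theorem exists_polynomial_det_one_add_smul (A : E →L[ℝ] E) :
    ∃ p : Polynomial ℝ, p.natDegree ≤ Module.finrank ℝ E ∧
      ∀ t : ℝ, p.eval t = (1 + t • A).det := by
  let b := Module.finBasis ℝ E
  let M := LinearMap.toMatrix b b (A : E →ₗ[ℝ] E)
  refine ⟨((Polynomial.X : Polynomial ℝ) • M.map Polynomial.C +
    (1 : Matrix _ _ ℝ).map Polynomial.C).det, ?_, fun t => ?_⟩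
  · simpa using Polynomial.natDegree_det_X_add_C_le M 1
  · have h1 : (1 + t • A).det = (1 + t • M).det := by
      rw [ContinuousLinearMap.det, ← LinearMap.det_toMatrix b]
      congr 1
      simp [M, LinearMap.toMatrix_one]
    rw [h1, ← Polynomial.coe_evalRingHom, RingHom.map_det]
    congr 1
    ext i j
    simp [Matrix.one_apply, apply_ite (Polynomial.eval t)]
    ring

theorem bijective_add_smul_of_lipschitz {u : E → E} {K : NNReal} (hu : LipschitzWith K u)
    {t : ℝ} (ht : 0 ≤ t) (htK : t * K < 1) : Function.Bijective fun x => x + t • u x := by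
  lift t to NNReal using ht
  rcases subsingleton_or_nontrivial E with hE | hE
  · exact ⟨Function.injective_of_subsingleton _, fun y => ⟨y, Subsingleton.elim _ _⟩⟩
  have h : ApproximatesLinearOn (fun x => x + (t : ℝ) • u x)
      ((ContinuousLinearEquiv.refl ℝ E : E ≃L[ℝ] E) : E →L[ℝ] E) univ (t * K) := by
    intro x _ y _
    have : x + (t : ℝ) • u x - (y + (t : ℝ) • u y) - (x - y) = (t : ℝ) • (u x - u y) := by
      rw [smul_sub]; abel
    simp only [ContinuousLinearEquiv.coe_refl, ContinuousLinearMap.coe_id', id]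
    rw [this, norm_smul, NNReal.coe_mul, Real.norm_of_nonneg (NNReal.coe_nonneg t), mul_assoc]
    gcongr
    simpa [dist_eq_norm] using hu.dist_le_mul x y
  have hc : Subsingleton E ∨ t * K <
      ‖((ContinuousLinearEquiv.refl ℝ E).symm : E →L[ℝ] E)‖₊⁻¹ := by
    right
    have : ‖((ContinuousLinearEquiv.refl ℝ E).symm : E →L[ℝ] E)‖₊ = 1 := by
      ext; simp
    rw [this, inv_one]
    exact_mod_cast htK
  exact ⟨injOn_univ.1 (h.injOn hc), h.surjective hc⟩

variable [MeasurableSpace E] [BorelSpace E] (μ : Measure E) [μ.IsAddHaarMeasure]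

/-- After v is cut off to zero outside the ball, x + t v(x) is for small t a bijection of the space
fixing the complement of the ball, so it maps the ball onto itself. Its Jacobian is positive, and
the change of variables formula gives the volume. -/
theorem exists_integral_det_one_add_smul_eq {v : E → E} (hv : ContDiff ℝ 1 v) {R : ℝ}
    (h0 : ∀ x ∈ sphere (0 : E) R, v x = 0) :
    ∃ ε > (0 : ℝ), ∀ t ∈ Ioo 0 ε,
      ∫ x in ball (0 : E) R, (1 + t • fderiv ℝ v x).det ∂μ = μ.real (ball 0 R) := by
  have hcd : Continuous (fderiv ℝ v) := hv.continuous_fderiv one_ne_zero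
  obtain ⟨M, hM⟩ := (isCompact_closedBall (0 : E) R).exists_bound_of_continuousOn
    hcd.continuousOn
  have hlip : LipschitzOnWith (Real.toNNReal M) v (closedBall 0 R) := by
    refine (convex_closedBall _ _).lipschitzOnWith_of_nnnorm_fderiv_le (𝕜 := ℝ)
      (fun x _ => (hv.differentiable one_ne_zero) x) fun x hx => ?_
    exact NNReal.coe_le_coe.1 ((hM x hx).trans (Real.le_coe_toNNReal M))
  set K := Real.toNNReal M
  have hu := lipschitzWith_indicator_ball hlip h0
  set u := (ball (0 : E) R).indicator v
  have hdet : ∀ᶠ A : E →L[ℝ] E in 𝓝 1, 0 < A.det := by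
    have : ContinuousAt (fun A : E →L[ℝ] E => A.det) 1 :=
      ContinuousLinearMap.continuous_det.continuousAt
    refine this.eventually (lt_mem_nhds ?_)
    simp [ContinuousLinearMap.det]
  obtain ⟨δ, hδ, hdet⟩ := Metric.eventually_nhds_iff.1 hdet
  -- The first bound makes t v a contraction, the second keeps 1 + t Dv in the region of positive
  -- determinant; K + 1 avoids division by zero.
  refine ⟨min (1 / (K + 1)) (δ / (K + 1)), by positivity, fun t ht => ?_⟩
  have ht0 : 0 < t := ht.1
  have ht1 : t * (K + 1) < 1 := by
    rw [← lt_div_iff₀ (by positivity)]; exact ht.2.trans_le (min_le_left _ _)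
  have ht2 : t * (K + 1) < δ := by
    rw [← lt_div_iff₀ (by positivity)]; exact ht.2.trans_le (min_le_right _ _)
  have hbij := bijective_add_smul_of_lipschitz hu ht0.le (by nlinarith)
  have himg : (fun x => x + t • u x) '' ball 0 R = ball 0 R := by
    have : (fun x => x + t • u x) '' (ball 0 R)ᶜ = (ball 0 R)ᶜ := by
      rw [image_congr (g := id), image_id]
      intro x hx
      simp [u, indicator_of_notMem hx]
    rw [image_compl_eq hbij] at this
    exact compl_injective this
  have hder : ∀ x ∈ ball (0 : E) R,
      HasFDerivWithinAt (fun x => x + t • u x) (1 + t • fderiv ℝ v x) (ball 0 R) x := by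
    intro x hx
    have h1 : HasFDerivAt (fun x => x + t • v x) (1 + t • fderiv ℝ v x) x :=
      (hasFDerivAt_id x).add (((hv.differentiable one_ne_zero) x).hasFDerivAt.const_smul t)
    refine h1.hasFDerivWithinAt.congr (fun y hy => ?_) ?_
    · simp [u, indicator_of_mem hy]
    · simp [u, indicator_of_mem hx]
  have hcv := integral_image_eq_integral_abs_det_fderiv_smul μ measurableSet_ball hder
    hbij.1.injOn (fun _ => (1 : ℝ))
  rw [himg] at hcv
  simp only [smul_eq_mul, mul_one, integral_const, measureReal_restrict_apply_univ] at hcv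
  rw [hcv]
  refine setIntegral_congr_fun measurableSet_ball fun x hx => ?_
  refine (abs_of_pos (hdet ?_)).symm
  rw [dist_eq_norm, add_sub_cancel_left, norm_smul, Real.norm_of_nonneg ht0.le]
  refine lt_of_le_of_lt ?_ ht2
  gcongr
  exact (hM x (ball_subset_closedBall hx)).trans ((Real.le_coe_toNNReal M).trans (by simp [K]))

/-- Lagrange interpolation writes det(1 + Dv) as a combination of the values det(1 + t Dv) at dim E
+ 1 small nodes t, with weights that do not depend on x and sum to 1. At each node the integral is
the volume of the ball. -/
theorem integral_det_one_add_eq {v : E → E} (hv : ContDiff ℝ 1 v) {R : ℝ}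
    (h0 : ∀ x ∈ sphere (0 : E) R, v x = 0) :
    ∫ x in ball (0 : E) R, (1 + fderiv ℝ v x).det ∂μ = μ.real (ball 0 R) := by
  obtain ⟨ε, hε, h⟩ := exists_integral_det_one_add_smul_eq μ hv h0
  set N := Module.finrank ℝ E
  let s : Finset ℕ := Finset.range (N + 1)
  -- The shift by 2 keeps the node for m = 0 strictly below ε.
  let τ : ℕ → ℝ := fun m => ε / (m + 2)
  have hτ : ∀ m, τ m ∈ Ioo 0 ε := fun m =>
    ⟨by positivity, by
      rw [div_lt_iff₀ (by positivity)]
      have : (0 : ℝ) ≤ m := m.cast_nonneg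
      nlinarith⟩
  have hinj : InjOn τ s := by
    intro m _ l _ hml
    have h2 : (m : ℝ) + 2 = l + 2 := by
      have h3 : ε / ((m : ℝ) + 2) = ε / (l + 2) := hml
      rw [div_eq_div_iff (by positivity) (by positivity)] at h3
      exact (mul_left_cancel₀ hε.ne' h3).symm
    exact_mod_cast add_right_cancel h2
  have hint : ∀ m, IntegrableOn (fun x => (1 + τ m • fderiv ℝ v x).det) (ball 0 R) μ := by
    intro m
    have hc : Continuous fun x => (1 + τ m • fderiv ℝ v x).det :=
      ContinuousLinearMap.continuous_det.comp
        (continuous_const.add ((hv.continuous_fderiv one_ne_zero).const_smul (τ m)))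
    exact (hc.continuousOn.integrableOn_compact (isCompact_closedBall 0 R)).mono_set
      ball_subset_closedBall
  have hlag : ∀ x, (1 + fderiv ℝ v x).det = ∑ m ∈ s,
      (1 + τ m • fderiv ℝ v x).det * (Lagrange.basis s τ m).eval 1 := by
    intro x
    obtain ⟨p, hp, hpe⟩ := exists_polynomial_det_one_add_smul (fderiv ℝ v x)
    have hdeg : p.degree < s.card := by
      refine Polynomial.degree_le_natDegree.trans_lt ?_
      simp only [s, Finset.card_range]
      exact_mod_cast Nat.lt_succ_of_le hp
    have := Lagrange.eq_interpolate hinj hdeg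
    have h1 := hpe 1
    rw [one_smul] at h1
    rw [← h1]
    nth_rewrite 1 [this]
    rw [Lagrange.interpolate_apply, Polynomial.eval_finsetSum]
    refine Finset.sum_congr rfl fun m _ => ?_
    rw [Polynomial.eval_mul, Polynomial.eval_C, hpe]
  simp_rw [hlag]
  rw [integral_finsetSum _ fun m _ => (hint m).mul_const _]
  simp_rw [integral_mul_const, h _ (hτ _)]
  rw [← Finset.mul_sum, ← Polynomial.eval_finsetSum, Lagrange.sum_basis hinj (by simp [s])]
  simp

end Degree

/-! ### The no-retraction theorem. -/

section NoRetraction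

variable {E : Type*} [NormedAddCommGroup E] [InnerProductSpace ℝ E] [FiniteDimensional ℝ E]

/-- Differentiating ‖F‖² = R² shows that F x is orthogonal to the range of the derivative, so the
derivative cannot be onto. -/
theorem det_fderiv_eq_zero_of_norm_eq [Nontrivial E] {F : E → E} {R : ℝ} (hR : 0 < R)
    (hF : Differentiable ℝ F) (hn : ∀ x, ‖F x‖ = R) (x : E) : (fderiv ℝ F x).det = 0 := by
  by_contra hdet
  have hsurj : Function.Surjective (fderiv ℝ F x) := by
    have h := (LinearMap.isUnit_iff_isUnit_det ((fderiv ℝ F x : E →L[ℝ] E) : E →ₗ[ℝ] E)).2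
      (IsUnit.mk0 _ hdet)
    exact ((Module.End.isUnit_iff _).1 h).2
  obtain ⟨w, hw⟩ := hsurj (F x)
  have h1 : HasFDerivAt (fun y => ‖F y‖ ^ 2) _ x := (hF x).hasFDerivAt.norm_sq
  have h2 : HasFDerivAt (fun y => ‖F y‖ ^ 2) (0 : E →L[ℝ] ℝ) x := by
    simp_rw [hn]; exact hasFDerivAt_const _ _
  have h3 := congrArg (fun f : E →L[ℝ] ℝ => f w) (h1.unique h2)
  simp [hw, hn] at h3
  exact hR.ne' h3

/-- Without a zero, a smoothing of h can be normalized radially to a C¹ map F into a sphere that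
fixes this sphere. The integral of det DF over the ball is then both its volume and zero. -/
theorem exists_eq_zero_of_eq_id_of_le_norm {h : E → E} (hc : Continuous h) {R : ℝ}
    (hid : ∀ x, R ≤ ‖x‖ → h x = x) : ∃ x, h x = 0 := by
  rcases subsingleton_or_nontrivial E with hE | hE
  · exact ⟨0, Subsingleton.elim _ _⟩
  by_contra! hne
  borelize E
  let μ : Measure E := Measure.addHaar
  have hpos : ∀ x, 0 < ‖h x‖ := fun x => norm_pos_iff.2 (hne x)
  -- Positive and larger than R, so that h is the identity, hence smooth, on a neighbourhood of ‖x‖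
  -- ≥ R₁.
  set R₁ := |R| + 1
  have hR₁ : 0 < R₁ := by positivity
  have hS : IsClosed {x : E | R₁ ≤ ‖x‖} := isClosed_le continuous_const continuous_norm
  have hU : {x : E | R < ‖x‖} ∈ 𝓝ˢ {x : E | R₁ ≤ ‖x‖} := by
    refine (isOpen_lt continuous_const continuous_norm).mem_nhdsSet.2 fun x hx => ?_
    have : R₁ ≤ ‖x‖ := hx
    have := le_abs_self R
    show R < ‖x‖
    linarith
  -- The error at x is below ‖h x‖, so g has no zero either.
  obtain ⟨g, hg, hgd, hgS, -⟩ := hc.exists_contDiff_approx_and_eqOn 1 hc.norm hpos hS hU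
    (contDiffOn_id.congr fun x hx => hid x (le_of_lt hx))
  have hg0 : ∀ x, g x ≠ 0 := by
    intro x hx
    have := hgd x
    rw [hx, dist_zero_left] at this
    exact lt_irrefl _ this
  let F : E → E := fun x => R₁ • (‖g x‖⁻¹ • g x)
  have hF : ContDiff ℝ 1 F := by
    refine ContDiff.const_smul _ (ContDiff.smul ?_ hg)
    exact (hg.norm ℝ hg0).inv fun x => norm_ne_zero_iff.2 (hg0 x)
  have hFn : ∀ x, ‖F x‖ = R₁ := by
    intro x
    have := norm_ne_zero_iff.2 (hg0 x)
    simp only [F, norm_smul, norm_inv, norm_norm]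
    rw [inv_mul_cancel₀ this, mul_one, Real.norm_of_nonneg hR₁.le]
  have hFS : ∀ x ∈ sphere (0 : E) R₁, F x - x = 0 := by
    intro x hx
    have hx' : ‖x‖ = R₁ := by simpa using hx
    have h1 : g x = x := by
      rw [hgS (show R₁ ≤ ‖x‖ from hx'.ge)]
      exact hid x (by rw [hx']; linarith [le_abs_self R])
    simp only [F, h1, hx', smul_smul]
    rw [mul_inv_cancel₀ hR₁.ne', one_smul, sub_self]
  have hint := integral_det_one_add_eq μ (hF.sub contDiff_id) (R := R₁) hFS
  have hzero : ∀ x, (1 + fderiv ℝ (F - id) x).det = 0 := by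
    intro x
    have hd := hF.differentiable one_ne_zero
    rw [fderiv_sub (hd x) differentiableAt_id, fderiv_id,
      show (1 : E →L[ℝ] E) + (fderiv ℝ F x - ContinuousLinearMap.id ℝ E) = fderiv ℝ F x from
        add_sub_cancel _ _]
    exact det_fderiv_eq_zero_of_norm_eq hR₁ hd hFn x
  have hzero' : ∀ x, (1 + fderiv ℝ (fun x => F x - id x) x).det = 0 := hzero
  simp only [hzero', integral_zero] at hint
  have : 0 < μ.real (ball 0 R₁) :=
    ENNReal.toReal_pos (measure_ball_pos μ 0 hR₁).ne' measure_ball_lt_top.ne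
  exact this.ne hint

end NoRetraction

/-! ### Zeros from a homotopy to a translation. -/

section Homotopy

variable {E : Type*} [NormedAddCommGroup E] [NormedSpace ℝ E] [FiniteDimensional ℝ E]

/-- A continuous self-map of a finite-dimensional space that is a translation outside of a bounded
set has a zero. -/
theorem exists_eq_zero_of_eq_sub_of_notMem {h : E → E} (hc : Continuous h) {U : Set E}
    (hU : Bornology.IsBounded U) (z₀ : E) (hid : ∀ x ∉ U, h x = x - z₀) : ∃ x, h x = 0 := by
  let e : E ≃L[ℝ] EuclideanSpace ℝ (Fin (Module.finrank ℝ E)) := toEuclidean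
  let H := fun x => e (h (e.symm x + z₀))
  have hH : Continuous H := by fun_prop
  obtain ⟨M, hM⟩ := isBounded_iff_forall_norm_le.1 hU
  let c := ‖(e : E →L[ℝ] EuclideanSpace ℝ (Fin (Module.finrank ℝ E)))‖
  have key : ∀ x, c * (M + ‖z₀‖) + 1 ≤ ‖x‖ → H x = x := by
    intro x hx
    have : e.symm x + z₀ ∉ U := by
      intro hmem
      have h1 := hM _ hmem
      have h2 : ‖e.symm x‖ ≤ M + ‖z₀‖ := by
        have := norm_sub_le (e.symm x + z₀) z₀
        rw [add_sub_cancel_right] at this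
        linarith
      have h3 := (e : E →L[ℝ] EuclideanSpace ℝ (Fin (Module.finrank ℝ E))).le_opNorm (e.symm x)
      have h4 : (e : E →L[ℝ] EuclideanSpace ℝ (Fin (Module.finrank ℝ E))) (e.symm x) = x :=
        e.apply_symm_apply x
      rw [h4] at h3
      have h5 : c * ‖e.symm x‖ ≤ c * (M + ‖z₀‖) := by gcongr
      have h6 : ‖x‖ ≤ c * ‖e.symm x‖ := h3
      linarith
    simp only [H]
    rw [hid _ this, add_sub_cancel_right, e.apply_symm_apply]
  obtain ⟨x, hx⟩ := exists_eq_zero_of_eq_id_of_le_norm hH key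
  exact ⟨_, e.map_eq_zero_iff.1 hx⟩

/-- A homotopy over a bounded open set, starting at an arbitrary map and ending at a translation
that vanishes in the set, and having no zeros near the frontier, starts at a map with a zero. -/
theorem exists_eq_zero_of_homotopy {U : Set E} (hU : IsOpen U) (hb : Bornology.IsBounded U)
    {z₀ : E} (hz₀ : z₀ ∈ U) {K : E × ℝ → E} (hK : ContinuousOn K (U ×ˢ Icc 0 1))
    (hK1 : ∀ z ∈ U, K (z, 1) = z - z₀)
    (hfr : ∀ y ∈ frontier U, ∀ s ∈ Icc (0 : ℝ) 1,
      ∀ᶠ q in 𝓝[U ×ˢ Icc 0 1] (y, s), K q ≠ 0) : ∃ z ∈ U, K (z, 0) = 0 := by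
  let Z' : Set (E × ℝ) := {q | q ∈ U ×ˢ Icc (0 : ℝ) 1 ∧ K q = 0}
  -- K is controlled only over U; the boundary hypothesis is what keeps limits of zeros inside U.
  have hZ'cl : IsClosed Z' := by
    rw [← isOpen_compl_iff, isOpen_iff_mem_nhds]
    rintro ⟨y, s⟩ hys
    by_cases hs : s ∈ Icc (0 : ℝ) 1
    · have hev : ∀ᶠ q in 𝓝[U ×ˢ Icc 0 1] (y, s), K q ≠ 0 := by
        by_cases hyU : y ∈ U
        · have : K (y, s) ≠ 0 := fun h => hys ⟨⟨hyU, hs⟩, h⟩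
          exact (hK (y, s) ⟨hyU, hs⟩).eventually_ne this
        · by_cases hcl : y ∈ closure U
          · exact hfr y (by rw [hU.frontier_eq]; exact ⟨hcl, hyU⟩) s hs
          · have : 𝓝[U ×ˢ Icc 0 1] (y, s) = ⊥ := by
              rw [← notMem_closure_iff_nhdsWithin_eq_bot, closure_prod_eq]
              exact fun h => hcl h.1
            rw [this]; exact eventually_bot
      filter_upwards [eventually_nhdsWithin_iff.1 hev] with q hq hq'
      exact hq hq'.1 hq'.2
    · filter_upwards [(isClosed_Icc.isOpen_compl.preimage continuous_snd).mem_nhds hs] with q hq hq'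
      exact hq hq'.1.2
  have hZ'c : IsCompact Z' := by
    refine (hb.isCompact_closure.prod (isCompact_Icc (a := (0 : ℝ)) (b := 1))).of_isClosed_subset
      hZ'cl ?_
    exact fun q hq => ⟨subset_closure hq.1.1, hq.1.2⟩
  have hZc : IsCompact (Prod.fst '' Z') := hZ'c.image continuous_fst
  have hZU : Prod.fst '' Z' ⊆ U := by rintro _ ⟨q, hq, rfl⟩; exact hq.1.1
  obtain ⟨f, hf1, -, hfU, hf01⟩ := exists_continuousMap_one_of_isCompact_subset_isOpen hZc hU hZU
  classical
  -- The Urysohn function f is 1 wherever K has a zero for some s, and its support lies in U. Thus h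
  -- is globally continuous, and each of its zeros in U is a zero of K at time 0.
  let h : E → E := fun z => if z ∈ U then K (z, 1 - f z) else z - z₀
  have hout : ∀ z ∉ tsupport f, h z = z - z₀ := by
    intro z hz
    by_cases hzU : z ∈ U
    · simp only [h, if_pos hzU, image_eq_zero_of_notMem_tsupport hz, sub_zero]
      exact hK1 z hzU
    · simp [h, hzU]
  have h01 : ∀ z, 1 - f z ∈ Icc (0 : ℝ) 1 := fun z =>
    ⟨by linarith [(hf01 z).2], by linarith [(hf01 z).1]⟩
  have hcont : Continuous h := by
    rw [continuous_iff_continuousAt]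
    intro z
    by_cases hz : z ∈ tsupport f
    · have hzU := hfU hz
      have hcU : ContinuousOn h U := by
        have : ContinuousOn (fun z => K (z, 1 - f z)) U :=
          hK.comp (by fun_prop) fun z hz => ⟨hz, h01 z⟩
        exact this.congr fun z hz => by simp [h, hz]
      exact hcU.continuousAt (hU.mem_nhds hzU)
    · have : ContinuousAt (fun z => z - z₀) z := by fun_prop
      refine this.congr ?_
      filter_upwards [(isClosed_tsupport f).isOpen_compl.mem_nhds hz] with w hw
      exact (hout w hw).symm
  obtain ⟨z, hz⟩ := exists_eq_zero_of_eq_sub_of_notMem hcont hb z₀ fun x hx => by simp [h, hx]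
  by_cases hzU : z ∈ U
  · simp only [h, if_pos hzU] at hz
    have h1 : f z = 1 := hf1 ⟨_, ⟨⟨hzU, h01 z⟩, hz⟩, rfl⟩
    rw [h1, sub_self] at hz
    exact ⟨z, hzU, hz⟩
  · simp only [h, if_neg hzU, sub_eq_zero] at hz
    exact absurd (hz ▸ hz₀) hzU

end Homotopy

/-- Near a point where some of the `p i` vanish, a combination of the `log (p i)` whose relevant
coefficients are nonnegative and not all zero tends to `-∞`. -/
theorem tendsto_sum_mul_log_atBot {ι X : Type*} [Fintype ι] {l : Filter X} {p β : ι → X → ℝ}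
    {p₀ β₀ : ι → ℝ} (hp : ∀ i, Tendsto (p i) l (𝓝 (p₀ i)))
    (hβ : ∀ i, Tendsto (β i) l (𝓝 (β₀ i))) (hpos : ∀ᶠ x in l, ∀ i, 0 < p i x)
    (hnonneg : ∀ i, p₀ i = 0 → ∀ᶠ x in l, 0 ≤ β i x) {i₀ : ι} (hi₀ : p₀ i₀ = 0)
    (hβ₀ : 0 < β₀ i₀) :
    Tendsto (fun x => ∑ i, β i x * Real.log (p i x)) l atBot := by
  classical
  have hmain : Tendsto (fun x => β i₀ x * Real.log (p i₀ x)) l atBot := by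
    refine (hβ i₀).pos_mul_atBot hβ₀ (Real.tendsto_log_nhdsGT_zero.comp ?_)
    refine tendsto_nhdsWithin_iff.2 ⟨hi₀ ▸ hp i₀, ?_⟩
    filter_upwards [hpos] with x hx using hx i₀
  -- The other terms are bounded above: eventually nonpositive if p₀ i = 0, convergent otherwise.
  have hbound : ∀ i, ∃ c, ∀ᶠ x in l, β i x * Real.log (p i x) ≤ c := by
    intro i
    by_cases h0 : p₀ i = 0
    · refine ⟨0, ?_⟩
      have h1 : ∀ᶠ x in l, p i x < 1 := (hp i).eventually_lt_const (by rw [h0]; exact one_pos)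
      filter_upwards [hnonneg i h0, h1, hpos] with x hx hx1 hx0
      exact mul_nonpos_of_nonneg_of_nonpos hx (Real.log_nonpos (hx0 i).le hx1.le)
    · refine ⟨β₀ i * Real.log (p₀ i) + 1, ?_⟩
      exact ((hβ i).mul ((hp i).log h0)).eventually_le_const (lt_add_one _)
  choose c hc using hbound
  refine tendsto_atBot_mono' l ?_
    (tendsto_atBot_add_const_right l (∑ i ∈ Finset.univ.erase i₀, c i) hmain)
  filter_upwards [eventually_all.2 hc] with x hx
  rw [← Finset.add_sum_erase _ _ (Finset.mem_univ i₀)]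
  gcongr with i
  exact hx i

/-! ### The polytope in affine coordinates. -/

section Chamber

variable {n k : ℕ} (D : Matrix (Fin n) (Fin (k + 1)) ℝ)

/-- The affine form `z ↦ ⟨P_i, (1, z)⟩` defined by the `i`-th row of `D`. -/
def affineForm (i : Fin n) (z : Fin k → ℝ) : ℝ :=
  D.row i ⬝ᵥ (Fin.cons 1 z : Fin (k + 1) → ℝ)

theorem affineForm_eq (i : Fin n) (z : Fin k → ℝ) :
    affineForm D i z = D i 0 + ∑ j, D i j.succ * z j := by
  simp [affineForm, dotProduct, Fin.sum_univ_succ]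

@[fun_prop]
theorem continuous_affineForm (i : Fin n) : Continuous (affineForm D i) := by
  simp only [funext (affineForm_eq D i)]
  fun_prop

theorem affineForm_sub (i : Fin n) (z w : Fin k → ℝ) :
    affineForm D i z - affineForm D i w = ∑ j, D i j.succ * (z j - w j) := by
  simp only [affineForm_eq, mul_sub, Finset.sum_sub_distrib]
  ring

/-- The set `Δ_P` in the affine coordinates `y_1, …, y_k`. -/
def chamber : Set (Fin k → ℝ) :=
  {z | ∀ i, 0 < affineForm D i z}

theorem mem_chamber_iff {z : Fin k → ℝ} :
    z ∈ chamber D ↔ (Fin.cons 1 z : Fin (k + 1) → ℝ) ∈ deltaP D := by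
  simp [chamber, deltaP, affineForm]

theorem isOpen_chamber : IsOpen (chamber D) := by
  simp only [chamber, ofPred_forall]
  exact isOpen_iInter_of_finite fun i => isOpen_lt continuous_const (continuous_affineForm D i)

variable {D}

theorem isBounded_chamber (h : Bornology.IsBounded (deltaP D)) :
    Bornology.IsBounded (chamber D) := by
  obtain ⟨M, hM⟩ := isBounded_iff_forall_norm_le.1 h
  refine isBounded_iff_forall_norm_le.2 ⟨M, fun z hz => ?_⟩
  refine le_trans ?_ (hM _ ((mem_chamber_iff D).1 hz))
  refine (pi_norm_le_iff_of_nonneg (norm_nonneg _)).2 fun j => ?_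
  simpa using norm_le_pi_norm (Fin.cons 1 z : Fin (k + 1) → ℝ) j.succ

theorem chamber_nonempty (h : (deltaP D).Nonempty) : (chamber D).Nonempty := by
  obtain ⟨y, hy⟩ := h
  refine ⟨Fin.tail y, (mem_chamber_iff D).2 ?_⟩
  rw [← hy.2, Fin.cons_self_tail]
  exact hy

theorem cons_mem_closure_deltaP {z : Fin k → ℝ} (hz : z ∈ closure (chamber D)) :
    (Fin.cons 1 z : Fin (k + 1) → ℝ) ∈ closure (deltaP D) := by
  have hc : Continuous fun z : Fin k → ℝ => (Fin.cons 1 z : Fin (k + 1) → ℝ) := by fun_prop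
  exact map_mem_closure hc hz fun w hw => (mem_chamber_iff D).1 hw

theorem dotProduct_nonneg_of_mem_closure {y : Fin (k + 1) → ℝ} (hy : y ∈ closure (deltaP D))
    (i : Fin n) : 0 ≤ D.row i ⬝ᵥ y := by
  have hcl : IsClosed {y : Fin (k + 1) → ℝ | 0 ≤ D.row i ⬝ᵥ y} :=
    isClosed_le continuous_const (by fun_prop)
  exact closure_minimal (fun w hw => (hw.1 i).le) hcl hy

end Chamber

/-! ### Consequences of uniformity for the rows of the Gale dual. -/

section Uniform

variable {d n k : ℕ} {C : Matrix (Fin d) (Fin n) ℝ} {D : Matrix (Fin n) (Fin (k + 1)) ℝ}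

theorem IsGaleDual.mulVec_mulVec_eq_zero {r s t : ℕ} {M : Matrix (Fin r) (Fin s) ℝ}
    {N : Matrix (Fin s) (Fin t) ℝ} (h : IsGaleDual M N) (y : Fin t → ℝ) :
    M.mulVec (N.mulVec y) = 0 := by
  have : N.mulVecLin y ∈ LinearMap.ker M.mulVecLin := by
    rw [← h.span_eq, ← Matrix.range_mulVecLin]
    exact LinearMap.mem_range_self _ _
  simpa using this

/-- If `C` is uniform, a nonzero vector is orthogonal to at most `k` rows of a Gale dual. -/
theorem card_orthogonal_rows_le (hn : n = d + k + 1) (hC : IsUniform C) (hD : IsGaleDual C D)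
    {y : Fin (k + 1) → ℝ} (hy : y ≠ 0) :
    (Finset.univ.filter fun i => D.row i ⬝ᵥ y = 0).card ≤ k := by
  by_contra! hlt
  set Z := Finset.univ.filter fun i => D.row i ⬝ᵥ y = 0 with hZ
  -- With k + 1 zeros, the kernel vector D y of C is supported on d indices, where the corresponding
  -- maximal minor of C forces it to vanish.
  have hcard : Zᶜ.card ≤ d := by
    rw [Finset.card_compl, Fintype.card_fin]; omega
  obtain ⟨T, hZT, hT⟩ := Finset.exists_superset_card_eq hcard
    (by rw [Fintype.card_fin]; omega)
  let f : Fin d ↪ Fin n := (T.orderEmbOfFin hT).toEmbedding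
  have hfr : ∀ i, i ∈ T → i ∈ range f := by
    intro i hi
    have := Finset.range_orderEmbOfFin T hT
    show i ∈ range (T.orderEmbOfFin hT)
    rw [this]; exact hi
  have hw0 : ∀ i, i ∉ range f → D.mulVec y i = 0 := by
    intro i hi
    by_contra hne
    have hZi : ¬ D.row i ⬝ᵥ y = 0 := hne
    exact hi (hfr i (hZT (by simpa [hZ] using hZi)))
  have hsub : (C.submatrix id f).mulVec (D.mulVec y ∘ f) = 0 := by
    ext r
    have h1 := congrFun (hD.mulVec_mulVec_eq_zero y) r
    rw [← h1]
    simp only [Matrix.mulVec, dotProduct, Matrix.submatrix_apply, id, Function.comp]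
    refine Finset.sum_of_injOn f f.injective.injOn (by simp) (fun i _ hi => ?_) (by simp)
    have := hw0 i (by simpa using hi)
    simp only [Matrix.mulVec, dotProduct] at this
    rw [this, mul_zero]
  have hwf := Matrix.eq_zero_of_mulVec_eq_zero (hC f) hsub
  have hw : D.mulVec y = 0 := by
    ext i
    by_cases hi : i ∈ range f
    · obtain ⟨j, rfl⟩ := hi
      exact congrFun hwf j
    · exact hw0 i hi
  exact hy (Matrix.mulVec_injective_iff.2 hD.linearIndependent (by simpa using hw))

/-- If `C` is uniform, the rows of a Gale dual orthogonal to a nonzero vector are independent. -/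
theorem row_notMem_span_of_orthogonal (hn : n = d + k + 1) (hC : IsUniform C)
    (hD : IsGaleDual C D) {y : Fin (k + 1) → ℝ} (hy : y ≠ 0) {m : Fin n}
    (hm : D.row m ⬝ᵥ y = 0) :
    D.row m ∉ Submodule.span ℝ (D.row '' {l | l ≠ m ∧ D.row l ⬝ᵥ y = 0}) := by
  intro hspan
  -- Some w ≠ 0 is orthogonal to the k rows in S other than m. If row m were in the span, w would be
  -- orthogonal to all k + 1 rows in S, which is too many.
  obtain ⟨S, hZS, hS⟩ := Finset.exists_superset_card_eq
    (Nat.le_succ_of_le (card_orthogonal_rows_le hn hC hD hy))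
    (by rw [Fintype.card_fin]; omega : k + 1 ≤ _)
  have hmS : m ∈ S := hZS (by simpa using hm)
  let φ : (Fin (k + 1) → ℝ) →ₗ[ℝ] ((S.erase m) → ℝ) :=
    (D.submatrix (Subtype.val : S.erase m → Fin n) id).mulVecLin
  have hφ : LinearMap.ker φ ≠ ⊥ := by
    apply LinearMap.ker_ne_bot_of_finrank_lt
    rw [Module.finrank_fintype_fun_eq_card, Module.finrank_fin_fun, Fintype.card_coe,
      Finset.card_erase_of_mem hmS, hS]
    omega
  obtain ⟨w, hw, hw0⟩ := (Submodule.ne_bot_iff _).1 hφ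
  have hwS : ∀ l ∈ S.erase m, D.row l ⬝ᵥ w = 0 := fun l hl => congrFun hw ⟨l, hl⟩
  have hwm : D.row m ⬝ᵥ w = 0 := by
    refine Submodule.span_induction (p := fun x _ => x ⬝ᵥ w = 0) ?_ ?_ ?_ ?_ hspan
    · rintro _ ⟨l, hl, rfl⟩
      exact hwS l (Finset.mem_erase.2 ⟨hl.1, hZS (by simpa using hl.2)⟩)
    · exact zero_dotProduct w
    · intro x x' _ _ hx hx'
      rw [add_dotProduct, hx, hx', add_zero]
    · intro c x _ hx
      rw [smul_dotProduct, hx, smul_zero]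
  have hle : S ⊆ Finset.univ.filter fun i => D.row i ⬝ᵥ w = 0 := by
    intro l hl
    by_cases hlm : l = m
    · simpa [hlm] using hwm
    · simpa using hwS l (Finset.mem_erase.2 ⟨hlm, hl⟩)
  have := (Finset.card_le_card hle).trans (card_orthogonal_rows_le hn hC hD hw0)
  omega

/-- If `C` is uniform, only generators of the cone can be orthogonal to a point of its dual. -/
theorem mem_of_isMinimalGeneratorSet (hn : n = d + k + 1) (hC : IsUniform C)
    (hD : IsGaleDual C D) {I : Set (Fin n)} (hI : IsMinimalGeneratorSet D I)
    {y : Fin (k + 1) → ℝ} (hy : y ≠ 0) (hnonneg : ∀ i, 0 ≤ D.row i ⬝ᵥ y) {m : Fin n}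
    (hm : D.row m ⬝ᵥ y = 0) : m ∈ I := by
  by_contra hmI
  have hmem : D.row m ∈ PointedCone.hull ℝ (D.row '' I) := by
    have h : PointedCone.hull ℝ (D.row '' I) = PointedCone.hull ℝ (range D.row) := hI.prop
    rw [h]
    exact PointedCone.subset_hull (mem_range_self m)
  refine row_notMem_span_of_orthogonal hn hC hD hy hm ?_
  set W := Submodule.span ℝ (D.row '' {l | l ≠ m ∧ D.row l ⬝ᵥ y = 0})
  -- In a conic combination of generators that pairs to zero with y, only generators orthogonal to y
  -- can occur.
  refine (Submodule.span_induction
    (p := fun x _ => 0 ≤ x ⬝ᵥ y ∧ (x ⬝ᵥ y = 0 → x ∈ W)) ?_ ?_ ?_ ?_ hmem).2 hm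
  · rintro _ ⟨l, hl, rfl⟩
    exact ⟨hnonneg l, fun h => Submodule.subset_span
      ⟨l, ⟨fun hlm => hmI (hlm ▸ hl), h⟩, rfl⟩⟩
  · exact ⟨(zero_dotProduct y).ge, fun _ => W.zero_mem⟩
  · intro x x' _ _ hx hx'
    rw [add_dotProduct]
    refine ⟨add_nonneg hx.1 hx'.1, fun h => W.add_mem (hx.2 ?_) (hx'.2 ?_)⟩ <;>
      linarith [hx.1, hx'.1]
  · intro c x _ hx
    have hsm : (c • x) ⬝ᵥ y = (c : ℝ) * (x ⬝ᵥ y) := smul_dotProduct (c : ℝ) x y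
    rw [hsm]
    refine ⟨mul_nonneg c.2 hx.1, fun h => ?_⟩
    rcases mul_eq_zero.1 h with h | h
    · have : c • x = (0 : Fin (k + 1) → ℝ) := by
        show (c : ℝ) • x = 0
        rw [h, zero_smul]
      rw [this]; exact W.zero_mem
    · exact W.smul_mem (c : ℝ) (hx.2 h)

end Uniform

/-! ### The Gale homotopy has no zeros near the boundary. -/

section Homotopy

variable {n k : ℕ}

/-- The face is exposed by minus the sum of the forms vanishing at y: it is nonpositive on the
closed polytope, attains 0 at y, and is 0 only where all these forms vanish. -/
theorem setOf_orthogonal_mem_faceFamily {D : Matrix (Fin n) (Fin (k + 1)) ℝ} {I : Set (Fin n)}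
    {y : Fin (k + 1) → ℝ} (hy : y ∈ closure (deltaP D)) (hI : {i | D.row i ⬝ᵥ y = 0} ⊆ I)
    (hne : {i | D.row i ⬝ᵥ y = 0}.Nonempty) : {i | D.row i ⬝ᵥ y = 0} ∈ faceFamily D I := by
  have hyF : y ∈ faceOf D {i | D.row i ⬝ᵥ y = 0} := by
    simp only [faceOf, mem_iInter]
    exact fun i hi => ⟨hy, hi⟩
  refine ⟨hI, hne, ⟨y, hyF⟩, fun _ => ?_⟩
  classical
  let ψ : (Fin (k + 1) → ℝ) →ₗ[ℝ] ℝ :=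
    { toFun := fun x => -∑ i with D.row i ⬝ᵥ y = 0, D.row i ⬝ᵥ x
      map_add' := fun x x' => by
        simp only [dotProduct_add, Finset.sum_add_distrib]; ring
      map_smul' := fun c x => by
        simp only [dotProduct_smul, ← Finset.smul_sum, RingHom.id_apply, smul_neg] }
  have hψ : ∀ x, ψ x = -∑ i with D.row i ⬝ᵥ y = 0, D.row i ⬝ᵥ x := fun _ => rfl
  refine ⟨LinearMap.toContinuousLinearMap ψ, ?_⟩
  have hψy : ψ y = 0 := by
    rw [hψ, Finset.sum_eq_zero (fun i hi => (Finset.mem_filter.1 hi).2), neg_zero]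
  have hnonpos : ∀ x ∈ closure (deltaP D), ψ x ≤ 0 := fun x hx => by
    rw [hψ, neg_nonpos]
    exact Finset.sum_nonneg fun i _ => dotProduct_nonneg_of_mem_closure hx i
  ext x
  simp only [LinearMap.coe_toContinuousLinearMap', mem_ofPred_eq]
  constructor
  · intro hx
    simp only [faceOf, mem_iInter] at hx
    obtain ⟨i, hi⟩ := hne
    refine ⟨(hx i hi).1, fun w hw => (hnonpos w hw).trans ?_⟩
    have hx0 : ∑ i with D.row i ⬝ᵥ y = 0, D.row i ⬝ᵥ x = 0 :=
      Finset.sum_eq_zero fun i hi => (hx i (Finset.mem_filter.1 hi).2).2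
    rw [hψ, hx0, neg_zero]
  · rintro ⟨hx, hmax⟩
    have h0 : ∑ i with D.row i ⬝ᵥ y = 0, D.row i ⬝ᵥ x = 0 := by
      have h1 := hmax y hy
      have h2 := hnonpos x hx
      rw [hψy] at h1
      have h3 := hψ x
      linarith
    rw [Finset.sum_eq_zero_iff_of_nonneg
      fun i _ => dotProduct_nonneg_of_mem_closure hx i] at h0
    simp only [faceOf, mem_iInter]
    exact fun i hi => ⟨hx, h0 i (Finset.mem_filter.2 ⟨Finset.mem_univ _, hi⟩)⟩

theorem exists_sign_of_not_isWeaklyMixed {ι p : Type*} {M : Matrix ι p ℝ}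
    (h : ¬ IsWeaklyMixed M) : ∃ j, ∃ σ : ℝ, (∀ i, 0 ≤ σ * M i j) ∧ ∃ i, 0 < σ * M i j := by
  simp only [IsWeaklyMixed, not_forall, not_or, not_and_or, not_exists, not_lt] at h
  obtain ⟨j, ⟨i, hi⟩, h | h⟩ := h
  · refine ⟨j, -1, fun l => by linarith [h l], i, ?_⟩
    linarith [lt_of_le_of_ne (h i) hi]
  · refine ⟨j, 1, fun l => by linarith [h l], i, ?_⟩
    linarith [lt_of_le_of_ne (h i) (Ne.symm hi)]

variable (B : Matrix (Fin n) (Fin k) ℝ) (D : Matrix (Fin n) (Fin (k + 1)) ℝ)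

/-- A homotopy from the logarithmic Gale system of `B` and `D` to the translation by `-z₀`, through
the logarithmic Gale systems of the matrices on the segment between `B` and `D`. -/
noncomputable def galeHomotopy (z₀ : Fin k → ℝ) (q : (Fin k → ℝ) × ℝ) : Fin k → ℝ :=
  fun j => (1 - q.2) * ∑ i, ((1 - q.2) * B i j + q.2 * D i j.succ) *
    Real.log (affineForm D i q.1) + q.2 * (q.1 j - z₀ j)

variable {B D}

theorem continuousOn_galeHomotopy (z₀ : Fin k → ℝ) :
    ContinuousOn (galeHomotopy B D z₀) (chamber D ×ˢ Icc 0 1) := by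
  refine continuousOn_pi.2 fun j => ?_
  have hlog : ∀ i, ContinuousOn (fun q : (Fin k → ℝ) × ℝ => Real.log (affineForm D i q.1))
      (chamber D ×ˢ Icc 0 1) := fun i =>
    ContinuousOn.log (by fun_prop) fun q hq => (hq.1 i).ne'
  unfold galeHomotopy
  fun_prop

theorem dotProduct_galeHomotopy (z₀ v : Fin k → ℝ) (q : (Fin k → ℝ) × ℝ) :
    v ⬝ᵥ galeHomotopy B D z₀ q =
      (1 - q.2) * ∑ i, (∑ j, v j * ((1 - q.2) * B i j + q.2 * D i j.succ)) *
        Real.log (affineForm D i q.1) + q.2 * (v ⬝ᵥ (q.1 - z₀)) := by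
  simp only [dotProduct, galeHomotopy, Pi.sub_apply]
  rw [Finset.sum_congr rfl fun j _ => mul_add _ _ _, Finset.sum_add_distrib]
  congr 1
  · simp only [Finset.mul_sum, Finset.sum_mul]
    rw [Finset.sum_comm]
    refine Finset.sum_congr rfl fun i _ => Finset.sum_congr rfl fun j _ => ?_
    ring
  · rw [Finset.mul_sum]
    exact Finset.sum_congr rfl fun j _ => by ring

/-- It suffices to find a fixed vector v whose pairing with the homotopy is negative near (y, s).
This holds if the coefficients of the logarithms of the vanishing forms are nonnegative near (y, s)
and one has a positive limit, provided that 1 - s stays positive or the linear term is negative. -/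
theorem eventually_galeHomotopy_ne_zero {z₀ y : Fin k → ℝ} (hz₀ : z₀ ∈ chamber D)
    (hy : y ∈ frontier (chamber D)) {s : ℝ} (hs : s ∈ Icc (0 : ℝ) 1)
    (hmixed : ¬ IsWeaklyMixed
      (B.submatrix (Subtype.val : {i | affineForm D i y = 0} → Fin n) id))
    (hsign : ∀ i, affineForm D i y = 0 → ∀ j, 0 ≤ B i j * D i j.succ)
    (hzero : ∀ i, affineForm D i y = 0 → ∀ j, B i j = 0 → D i j.succ = 0) :
    ∀ᶠ q in 𝓝[chamber D ×ˢ Icc 0 1] (y, s), galeHomotopy B D z₀ q ≠ 0 := by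
  set l := 𝓝[chamber D ×ˢ Icc 0 1] (y, s)
  have hmem : ∀ᶠ q in l, q ∈ chamber D ×ˢ Icc (0 : ℝ) 1 := self_mem_nhdsWithin
  have hpos : ∀ᶠ q in l, ∀ i, 0 < affineForm D i q.1 := hmem.mono fun q hq => hq.1
  have htend : ∀ {f : (Fin k → ℝ) × ℝ → ℝ}, Continuous f → Tendsto f l (𝓝 (f (y, s))) :=
    fun hf => hf.continuousAt.mono_left nhdsWithin_le_nhds
  have hp : ∀ i, Tendsto (fun q : (Fin k → ℝ) × ℝ => affineForm D i q.1) l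
      (𝓝 (affineForm D i y)) :=
    fun i => htend (f := fun q => affineForm D i q.1) (by fun_prop)
  have hβ : ∀ (v : Fin k → ℝ) (i : Fin n),
      Tendsto (fun q : (Fin k → ℝ) × ℝ => ∑ j, v j * ((1 - q.2) * B i j + q.2 * D i j.succ)) l
        (𝓝 (∑ j, v j * ((1 - s) * B i j + s * D i j.succ))) := fun v i =>
    htend (f := fun q => ∑ j, v j * ((1 - q.2) * B i j + q.2 * D i j.succ)) (by fun_prop)
  have hlin : ∀ v : Fin k → ℝ,
      Tendsto (fun q : (Fin k → ℝ) × ℝ => q.2 * (v ⬝ᵥ (q.1 - z₀))) l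
        (𝓝 (s * (v ⬝ᵥ (y - z₀)))) := fun v =>
    htend (f := fun q => q.2 * (v ⬝ᵥ (q.1 - z₀))) (by fun_prop)
  suffices ∃ v : Fin k → ℝ, ∀ᶠ q in l, v ⬝ᵥ galeHomotopy B D z₀ q < 0 by
    obtain ⟨v, hv⟩ := this
    filter_upwards [hv] with q hq h0
    rw [h0, dotProduct_zero] at hq
    exact lt_irrefl _ hq
  obtain ⟨j, σ, hσ, i₀, hi₀⟩ := exists_sign_of_not_isWeaklyMixed hmixed
  rcases hs.2.lt_or_eq with hs1 | rfl
  -- For s < 1 the signed coordinate j works: column j of B_L has constant sign σ, entries of D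
  -- there have the same sign or vanish, and the weight 1 - s of B stays positive.
  · refine ⟨Pi.single j σ, ?_⟩
    have hsimp : ∀ (i : Fin n) (t : ℝ),
        ∑ j', (Pi.single j σ : Fin k → ℝ) j' * ((1 - t) * B i j' + t * D i j'.succ) =
          σ * ((1 - t) * B i j + t * D i j.succ) := fun i t => by
      rw [Finset.sum_eq_single j (by intro b _ hb; simp [hb]) (by simp), Pi.single_eq_same]
    have hσD : ∀ i, affineForm D i y = 0 → 0 ≤ σ * D i j.succ := by
      intro i hi
      have h1 : 0 ≤ σ * B i j := hσ ⟨i, hi⟩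
      have h2 := hsign i hi j
      by_cases hb : B i j = 0
      · rw [hzero i hi j hb, mul_zero]
      · have h3 : 0 < B i j ^ 2 := by positivity
        by_contra! h4
        nlinarith [mul_nonneg h1 h2, mul_neg_of_pos_of_neg h3 h4]
    have hbot := tendsto_sum_mul_log_atBot hp (hβ (Pi.single j σ)) hpos
      (fun i hi => by
        filter_upwards [hmem] with q hq
        rw [hsimp]
        have h1 : 0 ≤ σ * B i j := hσ ⟨i, hi⟩
        nlinarith [mul_nonneg (sub_nonneg.2 hq.2.2) h1, mul_nonneg hq.2.1 (hσD i hi)])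
      (i₀ := i₀) i₀.2 (by
        rw [hsimp]
        have h1 : 0 < σ * B i₀ j := hi₀
        nlinarith [mul_pos (sub_pos.2 hs1) h1, mul_nonneg hs.1 (hσD i₀ i₀.2)])
    have h1s : Tendsto (fun q : (Fin k → ℝ) × ℝ => 1 - q.2) l (𝓝 (1 - s)) :=
      htend (f := fun q => 1 - q.2) (by fun_prop)
    have := (h1s.pos_mul_atBot (sub_pos.2 hs1) hbot).atBot_add (hlin (Pi.single j σ))
    simp only [dotProduct_galeHomotopy]
    exact this.eventually_lt_atBot 0
  -- For s = 1 the coefficient of log p_i tends to p_i(z₀) - p_i(y) = p_i(z₀) > 0 for each vanishing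
  -- form. The factor 1 - s may kill the divergence, but the linear term tends to -|z₀ - y|² < 0.
  · refine ⟨z₀ - y, ?_⟩
    have hlim : ∀ i, affineForm D i y = 0 →
        0 < ∑ j, (z₀ - y) j * ((1 - 1) * B i j + 1 * D i j.succ) := by
      intro i hi
      have h1 := affineForm_sub D i z₀ y
      rw [hi, sub_zero] at h1
      have h2 := hz₀ i
      rw [h1] at h2
      convert h2 using 2 with j
      simp only [Pi.sub_apply]
      ring
    have hbot := tendsto_sum_mul_log_atBot hp (hβ (z₀ - y)) hpos
      (fun i hi => ((hβ (z₀ - y) i).eventually_const_lt (hlim i hi)).mono fun _ h => h.le)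
      (i₀ := i₀) i₀.2 (hlim i₀ i₀.2)
    have hneg : (1 : ℝ) * ((z₀ - y) ⬝ᵥ (y - z₀)) < 0 := by
      rw [one_mul, ← neg_sub z₀ y, dotProduct_neg, neg_lt_zero]
      refine lt_of_le_of_ne (Finset.sum_nonneg fun j _ => mul_self_nonneg _) fun h => ?_
      have h0 := dotProduct_self_eq_zero.1 h.symm
      rw [sub_eq_zero] at h0
      rw [(isOpen_chamber D).frontier_eq] at hy
      exact hy.2 (h0 ▸ hz₀)
    filter_upwards [hbot.eventually_le_atBot 0, (hlin (z₀ - y)).eventually_lt_const hneg, hmem]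
      with q hq1 hq2 hq3
    rw [dotProduct_galeHomotopy]
    nlinarith [mul_nonneg (sub_nonneg.2 hq3.2.2) (neg_nonneg.2 hq1)]

end Homotopy

/-! ### From the Gale system back to the polynomial system. -/

section GaleSystem

variable {d n k : ℕ}

/-- A vector orthogonal to `ker M` is a combination of the rows of `M`. -/
theorem exists_eq_vecMul_of_orthogonal {r s t : ℕ} {M : Matrix (Fin r) (Fin s) ℝ}
    {N : Matrix (Fin s) (Fin t) ℝ} (h : Submodule.span ℝ (range N.col) = LinearMap.ker M.mulVecLin)
    {w : Fin s → ℝ} (hw : ∀ j, ∑ i, N i j * w i = 0) :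
    ∃ c : Fin r → ℝ, ∀ i, w i = ∑ l, c l * M l i := by
  let φ : Module.Dual ℝ (Fin s → ℝ) := dotProductBilin ℝ ℝ w
  have hφ : ∀ x, φ x = w ⬝ᵥ x := fun _ => rfl
  have hmem : φ ∈ (LinearMap.ker M.mulVecLin).dualAnnihilator := by
    rw [← h, Submodule.mem_dualAnnihilator]
    intro x hx
    refine Submodule.span_induction (p := fun x _ => φ x = 0) ?_ (map_zero φ) ?_ ?_ hx
    · rintro _ ⟨j, rfl⟩
      rw [hφ, ← hw j]
      exact Finset.sum_congr rfl fun i _ => mul_comm _ _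
    · intro x x' _ _ hx hx'
      rw [map_add, hx, hx', add_zero]
    · intro c x _ hx
      rw [map_smul, hx, smul_zero]
  rw [← LinearMap.range_dualMap_eq_dualAnnihilator_ker] at hmem
  obtain ⟨ψ, hψ⟩ := hmem
  refine ⟨fun l => ψ (Pi.single l 1), fun i => ?_⟩
  have h1 : φ (Pi.single i 1) = w i := by rw [hφ]; simp
  rw [← h1, ← hψ, LinearMap.dualMap_apply, Matrix.mulVecLin_apply, Matrix.mulVec_single_one]
  conv_lhs => rw [pi_eq_sum_univ' (M.col i), map_sum]
  refine Finset.sum_congr rfl fun l _ => ?_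
  rw [map_smul, smul_eq_mul, mul_comm]
  rfl

/-- A solution of the logarithmic Gale system gives a positive solution of the original system. -/
theorem positiveSolutions_nonempty_of_gale {a : Fin n → Fin d → ℝ} {C : Matrix (Fin d) (Fin n) ℝ}
    {B : Matrix (Fin n) (Fin k) ℝ} (hB : IsGaleDual (configMatrix a) B)
    {D : Matrix (Fin n) (Fin (k + 1)) ℝ} (hD : IsGaleDual C D) {y : Fin (k + 1) → ℝ}
    (hpos : ∀ i, 0 < D.row i ⬝ᵥ y) (hy : ∀ j, ∑ i, B i j * Real.log (D.row i ⬝ᵥ y) = 0) :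
    (positiveSolutions a C).Nonempty := by
  -- The logarithms lie in the row space of A: log⟨P_i, y⟩ = c_0 + ∑_l c_l a_il. Exponentiating the
  -- c_l with l ≥ 1 gives x whose monomials are e^(-c_0)⟨P_i, y⟩, a vector in ker C.
  obtain ⟨c, hc⟩ := exists_eq_vecMul_of_orthogonal hB.span_eq hy
  refine ⟨fun l => Real.exp (c l.succ), fun l => Real.exp_pos _, fun r => ?_⟩
  have hmon : ∀ i, ∏ l, Real.exp (c l.succ) ^ a i l = Real.exp (-c 0) * (D.row i ⬝ᵥ y) := by
    intro i
    rw [← Real.exp_log (hpos i), ← Real.exp_add, hc i, Fin.sum_univ_succ]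
    simp only [configMatrix, Matrix.of_apply, Fin.cons_zero, Fin.cons_succ, mul_one,
      neg_add_cancel_left, Real.exp_sum, ← Real.exp_mul]
  have hker := congrFun (hD.mulVec_mulVec_eq_zero y) r
  simp only [hmon]
  have : ∑ j, C r j * (Real.exp (-c 0) * (D.row j ⬝ᵥ y)) =
      Real.exp (-c 0) * (C.mulVec (D.mulVec y)) r := by
    simp only [Matrix.mulVec, dotProduct, Finset.mul_sum, Matrix.row]
    refine Finset.sum_congr rfl fun i _ => Finset.sum_congr rfl fun j _ => ?_
    ring
  rw [this, hker, Pi.zero_apply, mul_zero]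

end GaleSystem

end GaleDuality

/-! ### The existence theorem. -/

open GaleDuality
theorem theorem3p2 {d n k : ℕ} (hk : 1 ≤ k) (hn : n = d + k + 1)
    (a : Fin n → Fin d → ℝ) (ha : Function.Injective a)
    (C : Matrix (Fin d) (Fin n) ℝ) (hC : IsUniform C)
    (B : Matrix (Fin n) (Fin k) ℝ) (hB : IsGaleDual (configMatrix a) B)
    (D : Matrix (Fin n) (Fin (k + 1)) ℝ) (hD : IsGaleDual C D)
    (h0 : (0 : Fin d → ℝ) ∈ openColumnCone C)
    (hdim : Module.finrank ℝ (affineSpan ℝ (deltaP D)).direction = k)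
    (hbdd : Bornology.IsBounded (deltaP D))
    (I : Set (Fin n)) (hI : IsMinimalGeneratorSet D I)
    (h1 : ∀ L ∈ faceFamily D I, ¬ IsWeaklyMixed (B.submatrix (Subtype.val : L → Fin n) id))
    (h2 : ∀ i ∈ I,
      (∀ j : Fin k, 0 ≤ B i j * D i j.succ) ∧
      (∃ j : Fin k, 0 < B i j * D i j.succ) ∧
      (∀ j : Fin k, B i j = 0 → D i j.succ = 0)) :
    0 < numPositiveSolutions a C := by
  have hne : (deltaP D).Nonempty := by
    -- An empty polytope would have dimension 0, whereas k ≥ 1.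
    by_contra h
    rw [not_nonempty_iff_eq_empty] at h
    rw [h, AffineSubspace.span_empty, AffineSubspace.direction_bot, finrank_bot] at hdim
    omega
  obtain ⟨z₀, hz₀⟩ := chamber_nonempty hne
  have hfr : ∀ y ∈ frontier (chamber D), ∀ s ∈ Icc (0 : ℝ) 1,
      ∀ᶠ q in 𝓝[chamber D ×ˢ Icc 0 1] (y, s), galeHomotopy B D z₀ q ≠ 0 := by
    intro y hy s hs
    have hy' := hy
    rw [(isOpen_chamber D).frontier_eq] at hy'
    have hcl := cons_mem_closure_deltaP hy'.1
    have hY : (Fin.cons 1 y : Fin (k + 1) → ℝ) ≠ 0 := fun h => by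
      simpa using congrFun h 0
    have hnn := dotProduct_nonneg_of_mem_closure hcl
    -- Both hypotheses concern only indices in I, so a redundant row vanishing at y has to be
    -- excluded; uniformity of C does this.
    have hLI : {i | affineForm D i y = 0} ⊆ I := fun i hi =>
      mem_of_isMinimalGeneratorSet hn hC hD hI hY hnn hi
    have hLne : {i | affineForm D i y = 0}.Nonempty := by
      have h := hy'.2
      simp only [chamber, mem_ofPred_eq, not_forall, not_lt] at h
      obtain ⟨i, hi⟩ := h
      exact ⟨i, le_antisymm hi (hnn i)⟩
    exact eventually_galeHomotopy_ne_zero hz₀ hy hs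
      (h1 _ (setOf_orthogonal_mem_faceFamily hcl hLI hLne))
      (fun i hi => (h2 i (hLI hi)).1) fun i hi => (h2 i (hLI hi)).2.2
  obtain ⟨z, hz, hz0⟩ := exists_eq_zero_of_homotopy (isOpen_chamber D) (isBounded_chamber hbdd)
    hz₀ (continuousOn_galeHomotopy z₀) (fun z _ => by ext j; simp [galeHomotopy]) hfr
  have hsol := positiveSolutions_nonempty_of_gale hB hD hz fun j => by
    simpa [galeHomotopy, affineForm] using congrFun hz0 j
  exact Set.encard_pos.2 hsol
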